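/- Let $\mathbf{Vines}$ be the free braided monoidal category containing a commutative monoid: its objects are formal tensor products of copies of one generating object $[1]$ and the unit object, and its morphisms are generated, under composition and tensor product, by the associativity and unit constraints, the braiding, and morphisms $\iota:1\to[1]$, $\mu:[1]\otimes[1]\to[1]$, subject to exactly the axioms of a braided monoidal category together with the axioms making $([1],\mu,\iota)$ a commutative monoid ($\mu(\mu\otimes I)=\mu(I\otimes\mu)$, $\mu(\iota\otimes I)=\mu(I\otimes\iota)=I$, $\mu c_{[1],[1]}=\mu$). A quasi-commutative monoid in a monoidal category $\mathcal D$ is a monoid $(A,\mu,\iota)$ in $\mathcal D$ together with an isomorphism $R:A\otimes A\to A\otimes A$ such that (associativity and unit constraints suppressed) $$(R\otimes I)(I\otimes R)(R\otimes I)=(I\otimes R)(R\otimes I)(I\otimes R),$$ $$R(\iota\otimes I)=I\otimes\iota,\qquad R(I\otimes\iota)=\iota\otimes I,$$ $$R(I\otimes\mu)=(\mu\otimes I)(I\otimes R)(R\otimes I),\qquad R(\mu\otimes I)=(I\otimes\mu)(R\otimes I)(I\otimes R),$$ $$\mu R=\mu.$$ A homomorphism $(A,R_A)\to(B,R_B)$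 is a homomorphism of monoids $f:A\to B$ with $(f\otimes f)R_A=R_B(f\otimes f)$. Let $\mathcal D$ be any monoidal category. For a strong monoidal (not necessarily braided) functor $F:\mathbf{Vines}\to\mathcal D$, the object $F([1])$, with the monoid structure induced by $F$ and with $R$ the composite $F([1])\otimes F([1])\cong F([1]\otimes[1])\xrightarrow{F(c_{[1],[1]})}F([1]\otimes[1])\cong F([1])\otimes F([1])$, is a quasi-commutative monoid. The resulting functor $F\mapsto F([1])$, from the category of strong monoidal functors $\mathbf{Vines}\to\mathcal D$ and monoidal natural transformations to the category of quasi-commutative monoids in $\mathcal D$ and their homomorphisms, is an equivalence of categories. In particular, isomorphism classes of monoidal functors $\mathbf{Vines}\to\mathcal D$ are in one-to-one correspondence with isomorphism classes of quasi-commutative monoids in $\mathcal D$. -/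

import Mathlib

open CategoryTheory MonoidalCategory

universe v₁ v₂ u₁ u₂

/-! ### The free braided monoidal category containing a commutative monoid -/

/-- Objects of the free braided monoidal category containing a commutative monoid: formal
tensor products of copies of one generator and the unit object. -/
inductive Vines : Type
  | gen : Vines
  | unit : Vines
  | tensor : Vines → Vines → Vines

namespace Vines

/-- Formal morphisms: everything that can be built by composition and tensor product from
identities, the structure isomorphisms of a braided monoidal category (associators, unitors,
braidings and their inverses), and a unit `unit ⟶ gen` and a multiplication
`gen ⊗ gen ⟶ gen` on the generator. -/
inductive Hom : Vines → Vines → Type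
  | id (X : Vines) : Hom X X
  | comp {X Y Z : Vines} (f : Hom X Y) (g : Hom Y Z) : Hom X Z
  | whiskerLeft (X : Vines) {Y₁ Y₂ : Vines} (f : Hom Y₁ Y₂) :
      Hom (X.tensor Y₁) (X.tensor Y₂)
  | whiskerRight {X₁ X₂ : Vines} (f : Hom X₁ X₂) (Y : Vines) :
      Hom (X₁.tensor Y) (X₂.tensor Y)
  | α_hom (X Y Z : Vines) : Hom ((X.tensor Y).tensor Z) (X.tensor (Y.tensor Z))
  | α_inv (X Y Z : Vines) : Hom (X.tensor (Y.tensor Z)) ((X.tensor Y).tensor Z)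
  | l_hom (X : Vines) : Hom (unit.tensor X) X
  | l_inv (X : Vines) : Hom X (unit.tensor X)
  | ρ_hom (X : Vines) : Hom (X.tensor unit) X
  | ρ_inv (X : Vines) : Hom X (X.tensor unit)
  | β_hom (X Y : Vines) : Hom (X.tensor Y) (Y.tensor X)
  | β_inv (X Y : Vines) : Hom (Y.tensor X) (X.tensor Y)
  | one : Hom unit gen
  | mul : Hom (gen.tensor gen) gen

/-- The congruence on formal morphisms generated by the axioms of a category, of a monoidal
category, of a braiding, and of a commutative monoid structure on the generator. -/
inductive HomEquiv : ∀ {X Y : Vines}, Hom X Y → Hom X Y → Prop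
  -- congruence
  | refl {X Y : Vines} (f : Hom X Y) : HomEquiv f f
  | symm {X Y : Vines} {f g : Hom X Y} : HomEquiv f g → HomEquiv g f
  | trans {X Y : Vines} {f g h : Hom X Y} : HomEquiv f g → HomEquiv g h → HomEquiv f h
  | comp {X Y Z : Vines} {f f' : Hom X Y} {g g' : Hom Y Z} :
      HomEquiv f f' → HomEquiv g g' → HomEquiv (f.comp g) (f'.comp g')
  | whiskerLeft (X : Vines) {Y Z : Vines} {f f' : Hom Y Z} :
      HomEquiv f f' → HomEquiv (f.whiskerLeft X) (f'.whiskerLeft X)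
  | whiskerRight {Y Z : Vines} {f f' : Hom Y Z} (X : Vines) :
      HomEquiv f f' → HomEquiv (f.whiskerRight X) (f'.whiskerRight X)
  -- category
  | comp_id {X Y : Vines} (f : Hom X Y) : HomEquiv (f.comp (Hom.id Y)) f
  | id_comp {X Y : Vines} (f : Hom X Y) : HomEquiv ((Hom.id X).comp f) f
  | assoc {W X Y Z : Vines} (f : Hom W X) (g : Hom X Y) (h : Hom Y Z) :
      HomEquiv ((f.comp g).comp h) (f.comp (g.comp h))
  -- functoriality of the tensor product
  | whiskerLeft_id (X Y : Vines) :
      HomEquiv ((Hom.id Y).whiskerLeft X) (Hom.id (X.tensor Y))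
  | whiskerLeft_comp (W : Vines) {X Y Z : Vines} (f : Hom X Y) (g : Hom Y Z) :
      HomEquiv ((f.comp g).whiskerLeft W) ((f.whiskerLeft W).comp (g.whiskerLeft W))
  | id_whiskerRight (X Y : Vines) :
      HomEquiv ((Hom.id X).whiskerRight Y) (Hom.id (X.tensor Y))
  | comp_whiskerRight {W X Y : Vines} (f : Hom W X) (g : Hom X Y) (Z : Vines) :
      HomEquiv ((f.comp g).whiskerRight Z) ((f.whiskerRight Z).comp (g.whiskerRight Z))
  | whisker_exchange {W X Y Z : Vines} (f : Hom W X) (g : Hom Y Z) :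
      HomEquiv ((g.whiskerLeft W).comp (f.whiskerRight Z))
        ((f.whiskerRight Y).comp (g.whiskerLeft X))
  -- associator and unitors
  | α_hom_inv (X Y Z : Vines) :
      HomEquiv ((Hom.α_hom X Y Z).comp (Hom.α_inv X Y Z)) (Hom.id _)
  | α_inv_hom (X Y Z : Vines) :
      HomEquiv ((Hom.α_inv X Y Z).comp (Hom.α_hom X Y Z)) (Hom.id _)
  | α_naturality_left {X X' : Vines} (f : Hom X X') (Y Z : Vines) :
      HomEquiv (((f.whiskerRight Y).whiskerRight Z).comp (Hom.α_hom X' Y Z))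
        ((Hom.α_hom X Y Z).comp (f.whiskerRight (Y.tensor Z)))
  | α_naturality_middle (X : Vines) {Y Y' : Vines} (f : Hom Y Y') (Z : Vines) :
      HomEquiv (((f.whiskerLeft X).whiskerRight Z).comp (Hom.α_hom X Y' Z))
        ((Hom.α_hom X Y Z).comp ((f.whiskerRight Z).whiskerLeft X))
  | α_naturality_right (X Y : Vines) {Z Z' : Vines} (f : Hom Z Z') :
      HomEquiv ((f.whiskerLeft (X.tensor Y)).comp (Hom.α_hom X Y Z'))
        ((Hom.α_hom X Y Z).comp ((f.whiskerLeft Y).whiskerLeft X))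
  | l_hom_inv (X : Vines) : HomEquiv ((Hom.l_hom X).comp (Hom.l_inv X)) (Hom.id _)
  | l_inv_hom (X : Vines) : HomEquiv ((Hom.l_inv X).comp (Hom.l_hom X)) (Hom.id _)
  | l_naturality {X Y : Vines} (f : Hom X Y) :
      HomEquiv ((f.whiskerLeft unit).comp (Hom.l_hom Y)) ((Hom.l_hom X).comp f)
  | ρ_hom_inv (X : Vines) : HomEquiv ((Hom.ρ_hom X).comp (Hom.ρ_inv X)) (Hom.id _)
  | ρ_inv_hom (X : Vines) : HomEquiv ((Hom.ρ_inv X).comp (Hom.ρ_hom X)) (Hom.id _)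
  | ρ_naturality {X Y : Vines} (f : Hom X Y) :
      HomEquiv ((f.whiskerRight unit).comp (Hom.ρ_hom Y)) ((Hom.ρ_hom X).comp f)
  | pentagon (W X Y Z : Vines) :
      HomEquiv
        (((Hom.α_hom W X Y).whiskerRight Z).comp
          ((Hom.α_hom W (X.tensor Y) Z).comp ((Hom.α_hom X Y Z).whiskerLeft W)))
        ((Hom.α_hom (W.tensor X) Y Z).comp (Hom.α_hom W X (Y.tensor Z)))
  | triangle (X Y : Vines) :
      HomEquiv ((Hom.α_hom X unit Y).comp ((Hom.l_hom Y).whiskerLeft X))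
        ((Hom.ρ_hom X).whiskerRight Y)
  -- braiding
  | β_hom_inv (X Y : Vines) : HomEquiv ((Hom.β_hom X Y).comp (Hom.β_inv X Y)) (Hom.id _)
  | β_inv_hom (X Y : Vines) : HomEquiv ((Hom.β_inv X Y).comp (Hom.β_hom X Y)) (Hom.id _)
  | β_naturality_right (X : Vines) {Y Z : Vines} (f : Hom Y Z) :
      HomEquiv ((f.whiskerLeft X).comp (Hom.β_hom X Z))
        ((Hom.β_hom X Y).comp (f.whiskerRight X))
  | β_naturality_left {X Y : Vines} (f : Hom X Y) (Z : Vines) :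
      HomEquiv ((f.whiskerRight Z).comp (Hom.β_hom Y Z))
        ((Hom.β_hom X Z).comp (f.whiskerLeft Z))
  | hexagon_forward (X Y Z : Vines) :
      HomEquiv
        ((Hom.α_hom X Y Z).comp ((Hom.β_hom X (Y.tensor Z)).comp (Hom.α_hom Y Z X)))
        (((Hom.β_hom X Y).whiskerRight Z).comp
          ((Hom.α_hom Y X Z).comp ((Hom.β_hom X Z).whiskerLeft Y)))
  | hexagon_reverse (X Y Z : Vines) :
      HomEquiv
        ((Hom.α_inv X Y Z).comp ((Hom.β_hom (X.tensor Y) Z).comp (Hom.α_inv Z X Y)))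
        (((Hom.β_hom Y Z).whiskerLeft X).comp
          ((Hom.α_inv X Z Y).comp ((Hom.β_hom X Z).whiskerRight Y)))
  -- commutative monoid
  | one_mul : HomEquiv ((Hom.one.whiskerRight gen).comp Hom.mul) (Hom.l_hom gen)
  | mul_one : HomEquiv ((Hom.one.whiskerLeft gen).comp Hom.mul) (Hom.ρ_hom gen)
  | mul_assoc :
      HomEquiv ((Hom.mul.whiskerRight gen).comp Hom.mul)
        ((Hom.α_hom gen gen gen).comp ((Hom.mul.whiskerLeft gen).comp Hom.mul))
  | mul_comm : HomEquiv ((Hom.β_hom gen gen).comp Hom.mul) Hom.mul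

instance setoidHom (X Y : Vines) : Setoid (Hom X Y) :=
  ⟨HomEquiv, ⟨HomEquiv.refl, HomEquiv.symm, HomEquiv.trans⟩⟩

instance : Category.{0} Vines where
  Hom X Y := Quotient (setoidHom X Y)
  id X := ⟦Hom.id X⟧
  comp := Quotient.map₂ Hom.comp (fun _ _ hf _ _ hg => HomEquiv.comp hf hg)
  id_comp := by
    rintro X Y ⟨f⟩
    exact Quotient.sound (HomEquiv.id_comp f)
  comp_id := by
    rintro X Y ⟨f⟩
    exact Quotient.sound (HomEquiv.comp_id f)
  assoc := by
    rintro W X Y Z ⟨f⟩ ⟨g⟩ ⟨h⟩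
    exact Quotient.sound (HomEquiv.assoc f g h)

instance : MonoidalCategoryStruct Vines where
  tensorObj X Y := Vines.tensor X Y
  tensorUnit := Vines.unit
  whiskerLeft X _ _ f :=
    Quotient.map (Hom.whiskerLeft X) (fun _ _ h => HomEquiv.whiskerLeft X h) f
  whiskerRight f Y :=
    Quotient.map (fun f => Hom.whiskerRight f Y) (fun _ _ h => HomEquiv.whiskerRight Y h) f
  associator X Y Z :=
    ⟨⟦Hom.α_hom X Y Z⟧, ⟦Hom.α_inv X Y Z⟧,
      Quotient.sound (HomEquiv.α_hom_inv X Y Z), Quotient.sound (HomEquiv.α_inv_hom X Y Z)⟩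
  leftUnitor X :=
    ⟨⟦Hom.l_hom X⟧, ⟦Hom.l_inv X⟧,
      Quotient.sound (HomEquiv.l_hom_inv X), Quotient.sound (HomEquiv.l_inv_hom X)⟩
  rightUnitor X :=
    ⟨⟦Hom.ρ_hom X⟧, ⟦Hom.ρ_inv X⟧,
      Quotient.sound (HomEquiv.ρ_hom_inv X), Quotient.sound (HomEquiv.ρ_inv_hom X)⟩

instance : MonoidalCategory Vines where
  tensorHom_def _ _ := rfl
  id_tensorHom_id X Y :=
    Quotient.sound
      ((HomEquiv.comp (HomEquiv.id_whiskerRight X Y) (HomEquiv.whiskerLeft_id X Y)).trans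
        (HomEquiv.id_comp _))
  tensorHom_comp_tensorHom {X₁ Y₁ Z₁ X₂ Y₂ Z₂} := by
    rintro ⟨f₁⟩ ⟨f₂⟩ ⟨g₁⟩ ⟨g₂⟩
    refine Quotient.sound ?_
    refine (HomEquiv.assoc _ _ _).trans ?_
    refine (HomEquiv.comp (HomEquiv.refl _) (HomEquiv.assoc _ _ _).symm).trans ?_
    refine (HomEquiv.comp (HomEquiv.refl _)
      (HomEquiv.comp (HomEquiv.whisker_exchange _ _) (HomEquiv.refl _))).trans ?_
    refine (HomEquiv.comp (HomEquiv.refl _) (HomEquiv.assoc _ _ _)).trans ?_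
    refine (HomEquiv.assoc _ _ _).symm.trans ?_
    exact HomEquiv.comp (HomEquiv.comp_whiskerRight _ _ _).symm
      (HomEquiv.whiskerLeft_comp _ _ _).symm
  whiskerLeft_id X Y := Quotient.sound (HomEquiv.whiskerLeft_id X Y)
  id_whiskerRight X Y := Quotient.sound (HomEquiv.id_whiskerRight X Y)
  associator_naturality {X₁ X₂ X₃ Y₁ Y₂ Y₃} := by
    rintro ⟨f₁⟩ ⟨f₂⟩ ⟨f₃⟩
    refine Quotient.sound ?_
    refine (HomEquiv.comp (HomEquiv.comp (HomEquiv.comp_whiskerRight _ _ _)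
      (HomEquiv.refl _)) (HomEquiv.refl _)).trans ?_
    refine (HomEquiv.assoc _ _ _).trans ?_
    refine (HomEquiv.comp (HomEquiv.refl _) (HomEquiv.α_naturality_right _ _ _)).trans ?_
    refine (HomEquiv.assoc _ _ _).trans ?_
    refine (HomEquiv.comp (HomEquiv.refl _) (HomEquiv.assoc _ _ _).symm).trans ?_
    refine (HomEquiv.comp (HomEquiv.refl _)
      (HomEquiv.comp (HomEquiv.α_naturality_middle _ _ _) (HomEquiv.refl _))).trans ?_
    refine (HomEquiv.comp (HomEquiv.refl _) (HomEquiv.assoc _ _ _)).trans ?_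
    refine (HomEquiv.assoc _ _ _).symm.trans ?_
    refine (HomEquiv.comp (HomEquiv.α_naturality_left _ _ _) (HomEquiv.refl _)).trans ?_
    refine (HomEquiv.assoc _ _ _).trans ?_
    exact HomEquiv.comp (HomEquiv.refl _)
      (HomEquiv.comp (HomEquiv.refl _) (HomEquiv.whiskerLeft_comp _ _ _).symm)
  leftUnitor_naturality {X Y} := by
    rintro ⟨f⟩
    exact Quotient.sound (HomEquiv.l_naturality f)
  rightUnitor_naturality {X Y} := by
    rintro ⟨f⟩
    exact Quotient.sound (HomEquiv.ρ_naturality f)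
  pentagon W X Y Z := Quotient.sound (HomEquiv.pentagon W X Y Z)
  triangle X Y := Quotient.sound (HomEquiv.triangle X Y)

instance : BraidedCategory Vines where
  braiding X Y :=
    ⟨⟦Hom.β_hom X Y⟧, ⟦Hom.β_inv X Y⟧,
      Quotient.sound (HomEquiv.β_hom_inv X Y), Quotient.sound (HomEquiv.β_inv_hom X Y)⟩
  braiding_naturality_right X Y Z := by
    rintro ⟨f⟩
    exact Quotient.sound (HomEquiv.β_naturality_right X f)
  braiding_naturality_left {X Y} := by
    rintro ⟨f⟩ Z
    exact Quotient.sound (HomEquiv.β_naturality_left f Z)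
  hexagon_forward X Y Z := Quotient.sound (HomEquiv.hexagon_forward X Y Z)
  hexagon_reverse X Y Z := Quotient.sound (HomEquiv.hexagon_reverse X Y Z)

/-- The generator is a monoid ... -/
instance : MonObj gen where
  one := ⟦Hom.one⟧
  mul := ⟦Hom.mul⟧
  one_mul := Quotient.sound HomEquiv.one_mul
  mul_one := Quotient.sound HomEquiv.mul_one
  mul_assoc := Quotient.sound HomEquiv.mul_assoc

/-- ... and it is commutative. -/
instance : IsCommMonObj gen where
  mul_comm := Quotient.sound HomEquiv.mul_comm

end Vines

/-! ### Strong monoidal functors and monoidal natural transformations -/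

/-- Monoidal functors, in the strong sense (the structure maps are isomorphisms). -/
structure StrongMonoidalFunctor (C : Type u₁) [Category.{v₁} C] [MonoidalCategory C]
    (D : Type u₂) [Category.{v₂} D] [MonoidalCategory D] extends C ⥤ D where
  /-- The structure isomorphisms and their coherence. -/
  monoidal : toFunctor.Monoidal

namespace StrongMonoidalFunctor

variable {C : Type u₁} [Category.{v₁} C] [MonoidalCategory C]
  {D : Type u₂} [Category.{v₂} D] [MonoidalCategory D]

attribute [instance] StrongMonoidalFunctor.monoidal

/-- Morphisms of monoidal functors are monoidal natural transformations. -/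
@[ext]
structure Hom (F G : StrongMonoidalFunctor C D) where
  hom : F.toFunctor ⟶ G.toFunctor
  isMonoidal : NatTrans.IsMonoidal hom

attribute [instance] Hom.isMonoidal

instance : Category (StrongMonoidalFunctor C D) where
  Hom := Hom
  id F := ⟨𝟙 F.toFunctor, inferInstance⟩
  comp f g := ⟨f.hom ≫ g.hom, inferInstance⟩

end StrongMonoidalFunctor

/-! ### Quasi-commutative monoids -/

open scoped MonObj

/-- A quasi-commutative monoid in a monoidal category: a monoid `X` together with an invertible
Yang-Baxter operator `R` on `X`, compatible with the unit and the multiplication, such that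
`R ≫ μ = μ`. -/
structure QuasiCommMon (D : Type u₂) [Category.{v₂} D] [MonoidalCategory D] where
  X : D
  [mon : MonObj X]
  R : X ⊗ X ≅ X ⊗ X
  yang_baxter :
    R.hom ▷ X ≫ (α_ X X X).hom ≫ X ◁ R.hom ≫ (α_ X X X).inv ≫ R.hom ▷ X =
      (α_ X X X).hom ≫ X ◁ R.hom ≫ (α_ X X X).inv ≫ R.hom ▷ X ≫ (α_ X X X).hom ≫
        X ◁ R.hom ≫ (α_ X X X).inv
  one_left : η[X] ▷ X ≫ R.hom = (λ_ X).hom ≫ (ρ_ X).inv ≫ X ◁ η[X]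
  one_right : X ◁ η[X] ≫ R.hom = (ρ_ X).hom ≫ (λ_ X).inv ≫ η[X] ▷ X
  mul_right :
    X ◁ μ[X] ≫ R.hom =
      (α_ X X X).inv ≫ R.hom ▷ X ≫ (α_ X X X).hom ≫ X ◁ R.hom ≫ (α_ X X X).inv ≫ μ[X] ▷ X
  mul_left :
    μ[X] ▷ X ≫ R.hom =
      (α_ X X X).hom ≫ X ◁ R.hom ≫ (α_ X X X).inv ≫ R.hom ▷ X ≫ (α_ X X X).hom ≫ X ◁ μ[X]
  mul_comm : R.hom ≫ μ[X] = μ[X]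

namespace QuasiCommMon

variable {D : Type u₂} [Category.{v₂} D] [MonoidalCategory D]

attribute [instance] QuasiCommMon.mon

/-- Homomorphisms of quasi-commutative monoids: monoid homomorphisms that commute with the
Yang-Baxter operators. -/
@[ext]
structure Hom (A B : QuasiCommMon D) where
  hom : A.X ⟶ B.X
  isMonHom : IsMonHom hom
  comm : A.R.hom ≫ (hom ⊗ₘ hom) = (hom ⊗ₘ hom) ≫ B.R.hom

attribute [instance] Hom.isMonHom

instance : Category (QuasiCommMon D) where
  Hom := Hom
  id A := ⟨𝟙 A.X, inferInstance, by simp⟩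
  comp f g := ⟨f.hom ≫ g.hom, inferInstance, by
    rw [← tensorHom_comp_tensorHom, ← Category.assoc, f.comm, Category.assoc, g.comm,
      Category.assoc]⟩

end QuasiCommMon

/-! ### The image of a commutative monoid under a monoidal functor -/

section Image

variable {C : Type u₁} [Category.{v₁} C] [MonoidalCategory C] [BraidedCategory C]
  {D : Type u₂} [Category.{v₂} D] [MonoidalCategory D]

open Functor Functor.LaxMonoidal Functor.OplaxMonoidal Functor.Monoidal

set_option linter.unusedSimpArgs false in
/-- The image of a commutative monoid `A` of a braided monoidal category `C` under a (not
necessarily braided) monoidal functor `F : C ⥤ D`, as a quasi-commutative monoid in `D`. Its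
multiplication is `F A ⊗ F A ≅ F (A ⊗ A) ⟶ F A`, its unit is `𝟙_ ≅ F 𝟙_ ⟶ F A`, and its
Yang-Baxter operator is `F A ⊗ F A ≅ F (A ⊗ A) ≅ F (A ⊗ A) ≅ F A ⊗ F A`, the middle map being
the image of the braiding of `A` with itself. -/
def StrongMonoidalFunctor.image (F : StrongMonoidalFunctor C D) (A : C) [MonObj A]
    [IsCommMonObj A] : QuasiCommMon D where
  X := F.obj A
  mon := F.toFunctor.monObjObj A
  R := μIso F.toFunctor A A ≪≫ F.mapIso (β_ A A) ≪≫ (μIso F.toFunctor A A).symm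
  yang_baxter := by
    have h : (β_ A A).hom ▷ A ≫ (α_ A A A).hom ≫ A ◁ (β_ A A).hom ≫ (α_ A A A).inv ≫
        (β_ A A).hom ▷ A =
        (α_ A A A).hom ≫ A ◁ (β_ A A).hom ≫ (α_ A A A).inv ≫ (β_ A A).hom ▷ A ≫
          (α_ A A A).hom ≫ A ◁ (β_ A A).hom ≫ (α_ A A A).inv := by
      rw [← cancel_epi (α_ A A A).inv, ← cancel_mono (α_ A A A).hom]
      simpa using BraidedCategory.yang_baxter A A A
    have h' := (LaxMonoidal.μ F.toFunctor A A ▷ F.obj A ≫ LaxMonoidal.μ F.toFunctor (A ⊗ A) A) ≫=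
      congrArg F.map h =≫ (δ F.toFunctor (A ⊗ A) A ≫ δ F.toFunctor A A ▷ F.obj A)
    simp only [Functor.map_comp, map_associator, map_associator_inv, map_leftUnitor,
      map_leftUnitor_inv, map_rightUnitor, map_rightUnitor_inv, map_whiskerLeft,
      map_whiskerRight, Category.assoc, Category.comp_id, μ_δ_assoc, δ_μ_assoc, μ_δ, δ_μ,
      whiskerRight_μ_δ_assoc, whiskerLeft_μ_δ_assoc, whiskerRight_μ_δ, whiskerLeft_μ_δ,
      whiskerRight_ε_η_assoc, whiskerLeft_ε_η_assoc] at h'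
    simpa only [Iso.trans_hom, Iso.symm_hom, μIso_hom, μIso_inv, mapIso_hom, obj.η_def, obj.μ_def,
      comp_whiskerRight, MonoidalCategory.whiskerLeft_comp, Category.assoc] using h'
  one_left := by
    have h : η[A] ▷ A ≫ (β_ A A).hom = (λ_ A).hom ≫ (ρ_ A).inv ≫ A ◁ η[A] := by
      simp
    have h' := (ε F.toFunctor ▷ F.obj A ≫ LaxMonoidal.μ F.toFunctor (𝟙_ C) A) ≫=
      congrArg F.map h =≫ δ F.toFunctor A A
    simp only [Functor.map_comp, map_associator, map_associator_inv, map_leftUnitor,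
      map_leftUnitor_inv, map_rightUnitor, map_rightUnitor_inv, map_whiskerLeft,
      map_whiskerRight, Category.assoc, Category.comp_id, μ_δ_assoc, δ_μ_assoc, μ_δ, δ_μ,
      whiskerRight_μ_δ_assoc, whiskerLeft_μ_δ_assoc, whiskerRight_μ_δ, whiskerLeft_μ_δ,
      whiskerRight_ε_η_assoc, whiskerLeft_ε_η_assoc] at h'
    simpa only [Iso.trans_hom, Iso.symm_hom, μIso_hom, μIso_inv, mapIso_hom, obj.η_def, obj.μ_def,
      comp_whiskerRight, MonoidalCategory.whiskerLeft_comp, Category.assoc] using h'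
  one_right := by
    have h : A ◁ η[A] ≫ (β_ A A).hom = (ρ_ A).hom ≫ (λ_ A).inv ≫ η[A] ▷ A := by
      simp
    have h' := (F.obj A ◁ ε F.toFunctor ≫ LaxMonoidal.μ F.toFunctor A (𝟙_ C)) ≫=
      congrArg F.map h =≫ δ F.toFunctor A A
    simp only [Functor.map_comp, map_associator, map_associator_inv, map_leftUnitor,
      map_leftUnitor_inv, map_rightUnitor, map_rightUnitor_inv, map_whiskerLeft,
      map_whiskerRight, Category.assoc, Category.comp_id, μ_δ_assoc, δ_μ_assoc, μ_δ, δ_μ,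
      whiskerRight_μ_δ_assoc, whiskerLeft_μ_δ_assoc, whiskerRight_μ_δ, whiskerLeft_μ_δ,
      whiskerRight_ε_η_assoc, whiskerLeft_ε_η_assoc] at h'
    simpa only [Iso.trans_hom, Iso.symm_hom, μIso_hom, μIso_inv, mapIso_hom, obj.η_def, obj.μ_def,
      comp_whiskerRight, MonoidalCategory.whiskerLeft_comp, Category.assoc] using h'
  mul_right := by
    have h : A ◁ μ[A] ≫ (β_ A A).hom = (α_ A A A).inv ≫ (β_ A A).hom ▷ A ≫ (α_ A A A).hom ≫
        A ◁ (β_ A A).hom ≫ (α_ A A A).inv ≫ μ[A] ▷ A := by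
      simp
    have h' := (F.obj A ◁ LaxMonoidal.μ F.toFunctor A A ≫ LaxMonoidal.μ F.toFunctor A (A ⊗ A)) ≫=
      congrArg F.map h =≫ δ F.toFunctor A A
    simp only [Functor.map_comp, map_associator, map_associator_inv, map_leftUnitor,
      map_leftUnitor_inv, map_rightUnitor, map_rightUnitor_inv, map_whiskerLeft,
      map_whiskerRight, Category.assoc, Category.comp_id, μ_δ_assoc, δ_μ_assoc, μ_δ, δ_μ,
      whiskerRight_μ_δ_assoc, whiskerLeft_μ_δ_assoc, whiskerRight_μ_δ, whiskerLeft_μ_δ,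
      whiskerRight_ε_η_assoc, whiskerLeft_ε_η_assoc] at h'
    simpa only [Iso.trans_hom, Iso.symm_hom, μIso_hom, μIso_inv, mapIso_hom, obj.η_def, obj.μ_def,
      comp_whiskerRight, MonoidalCategory.whiskerLeft_comp, Category.assoc] using h'
  mul_left := by
    have h : μ[A] ▷ A ≫ (β_ A A).hom = (α_ A A A).hom ≫ A ◁ (β_ A A).hom ≫ (α_ A A A).inv ≫
        (β_ A A).hom ▷ A ≫ (α_ A A A).hom ≫ A ◁ μ[A] := by
      simp
    have h' := (LaxMonoidal.μ F.toFunctor A A ▷ F.obj A ≫ LaxMonoidal.μ F.toFunctor (A ⊗ A) A) ≫=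
      congrArg F.map h =≫ δ F.toFunctor A A
    simp only [Functor.map_comp, map_associator, map_associator_inv, map_leftUnitor,
      map_leftUnitor_inv, map_rightUnitor, map_rightUnitor_inv, map_whiskerLeft,
      map_whiskerRight, Category.assoc, Category.comp_id, μ_δ_assoc, δ_μ_assoc, μ_δ, δ_μ,
      whiskerRight_μ_δ_assoc, whiskerLeft_μ_δ_assoc, whiskerRight_μ_δ, whiskerLeft_μ_δ,
      whiskerRight_ε_η_assoc, whiskerLeft_ε_η_assoc] at h'
    simpa only [Iso.trans_hom, Iso.symm_hom, μIso_hom, μIso_inv, mapIso_hom, obj.η_def, obj.μ_def,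
      comp_whiskerRight, MonoidalCategory.whiskerLeft_comp, Category.assoc] using h'
  mul_comm := by
    have h' := LaxMonoidal.μ F.toFunctor A A ≫= congrArg F.map (IsCommMonObj.mul_comm A)
    rw [F.map_comp] at h'
    change (_ ≫ _ ≫ δ F.toFunctor A A) ≫ LaxMonoidal.μ F.toFunctor A A ≫ F.map μ[A] = _
    simpa [-IsCommMonObj.mul_comm] using h'

/-- Evaluation of monoidal functors `C ⥤ D` at a commutative monoid `A` of `C`. -/
def evalAtCommMonoid (A : C) [MonObj A] [IsCommMonObj A] :
    StrongMonoidalFunctor C D ⥤ QuasiCommMon D where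
  obj F := F.image A
  map {F G} f :=
    { hom := f.hom.app A
      isMonHom := @IsMonHom.mk _ _ _ _ _ (F.image A).mon (G.image A).mon _
        (by
          change (ε F.toFunctor ≫ F.map η[A]) ≫ f.hom.app A = ε G.toFunctor ≫ G.map η[A]
          rw [← NatTrans.IsMonoidal.unit (τ := f.hom), Category.assoc, Category.assoc,
            f.hom.naturality])
        (by
          change (LaxMonoidal.μ F.toFunctor A A ≫ F.map μ[A]) ≫ f.hom.app A =
            (f.hom.app A ⊗ₘ f.hom.app A) ≫ LaxMonoidal.μ G.toFunctor A A ≫ G.map μ[A]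
          rw [← NatTrans.IsMonoidal.tensor_assoc (τ := f.hom), Category.assoc, f.hom.naturality])
      comm := by
        change (LaxMonoidal.μ F.toFunctor A A ≫ F.map (β_ A A).hom ≫ δ F.toFunctor A A) ≫
            (f.hom.app A ⊗ₘ f.hom.app A) =
          (f.hom.app A ⊗ₘ f.hom.app A) ≫
            LaxMonoidal.μ G.toFunctor A A ≫ G.map (β_ A A).hom ≫ δ G.toFunctor A A
        rw [← NatTrans.IsMonoidal.tensor_assoc (τ := f.hom),
          ← cancel_mono (LaxMonoidal.μ G.toFunctor A A)]
        simp only [Category.assoc, δ_μ, Category.comp_id]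
        rw [← NatTrans.IsMonoidal.tensor (τ := f.hom), δ_μ_assoc, f.hom.naturality] }
  map_id _ := rfl
  map_comp _ _ := rfl

end Image

/-! `Vines` is given by generators and relations, so a monoidal functor out of it is an
interpretation of formal morphisms that respects the relations. Given a quasi-commutative monoid
`A`, interpret formal tensor products strictly and build the braiding of any two of them from `A.R`
by the hexagon recipes. All relations except three groups are then formal. The first hexagon is
built into `braid`. The second is `braid_tensor_left`, which rests on the interchange law
(`exchangeLeft_exchangeRight`). The monoid relations are those of `A`, with `mul_comm` for
commutativity. The real content is naturality of the braiding against every formal morphism. Because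
braidings are built one factor at a time, `slides_interpHom` reduces it to the generators `R`, `η`,
`μ` crossing one copy of `A.X`. On one side these are `yang_baxter`, `one_left`, `mul_left`; on the
other, `yang_baxter`, `one_right`, `mul_right`. So the axioms are exactly what makes the
interpretation descend to the quotient, whence essential surjectivity. For full faithfulness,
invertibility of `ε` and `μ` forces a monoidal transformation to be determined by its component at
`gen` (`extend_unique`). Conversely, a component at `gen` extends recursively. Structural morphisms
are natural for free, and the hexagons reduce all braidings to that of `gen` with itself. Naturality
thus comes down to the three equations defining a homomorphism of quasi-commutative monoids. -/

/-! ### Exchanging a tensor product with an object -/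

section Exchange

variable {D : Type u₂} [Category.{v₂} D] [MonoidalCategory D]

/-- Moving `X ⊗ Y` past `Z`, one factor at a time. -/
def exchangeLeft {X Y Z : D} (a : X ⊗ Z ≅ Z ⊗ X) (b : Y ⊗ Z ≅ Z ⊗ Y) :
    (X ⊗ Y) ⊗ Z ≅ Z ⊗ (X ⊗ Y) :=
  α_ X Y Z ≪≫ whiskerLeftIso X b ≪≫ (α_ X Z Y).symm ≪≫ whiskerRightIso a Y ≪≫ α_ Z X Y

/-- Moving `X` past `Y ⊗ Z`, one factor at a time. -/
def exchangeRight {X Y Z : D} (a : X ⊗ Y ≅ Y ⊗ X) (b : X ⊗ Z ≅ Z ⊗ X) :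
    X ⊗ (Y ⊗ Z) ≅ (Y ⊗ Z) ⊗ X :=
  (exchangeLeft a.symm b.symm).symm

/-- Moving the unit object past `Z`. -/
def exchangeUnit (Z : D) : 𝟙_ D ⊗ Z ≅ Z ⊗ 𝟙_ D :=
  λ_ Z ≪≫ (ρ_ Z).symm

theorem exchangeLeft_hom {X Y Z : D} (a : X ⊗ Z ≅ Z ⊗ X) (b : Y ⊗ Z ≅ Z ⊗ Y) :
    (exchangeLeft a b).hom =
      (α_ X Y Z).hom ≫ X ◁ b.hom ≫ (α_ X Z Y).inv ≫ a.hom ▷ Y ≫ (α_ Z X Y).hom :=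
  rfl

theorem exchangeRight_hom {X Y Z : D} (a : X ⊗ Y ≅ Y ⊗ X) (b : X ⊗ Z ≅ Z ⊗ X) :
    (exchangeRight a b).hom =
      (α_ X Y Z).inv ≫ a.hom ▷ Z ≫ (α_ Y X Z).hom ≫ Y ◁ b.hom ≫ (α_ Y Z X).inv := by
  simp [exchangeRight, exchangeLeft]

theorem exchangeUnit_hom (Z : D) : (exchangeUnit Z).hom = (λ_ Z).hom ≫ (ρ_ Z).inv :=
  rfl

/-- `f` commutes with moving objects past `Z`. -/
def Slides {X Y Z : D} (f : X ⟶ Y) (a : X ⊗ Z ≅ Z ⊗ X) (b : Y ⊗ Z ≅ Z ⊗ Y) : Prop :=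
  f ▷ Z ≫ b.hom = a.hom ≫ Z ◁ f

namespace Slides

variable {W X Y Z : D}

theorem id (a : X ⊗ Z ≅ Z ⊗ X) : Slides (𝟙 X) a a := by
  simp [Slides]

theorem comp {f : W ⟶ X} {g : X ⟶ Y} {a : W ⊗ Z ≅ Z ⊗ W} {b : X ⊗ Z ≅ Z ⊗ X}
    {c : Y ⊗ Z ≅ Z ⊗ Y} (hf : Slides f a b) (hg : Slides g b c) : Slides (f ≫ g) a c := by
  simp only [Slides] at *
  rw [comp_whiskerRight, Category.assoc, hg, reassoc_of% hf, MonoidalCategory.whiskerLeft_comp]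

theorem inv {f : X ≅ Y} {a : X ⊗ Z ≅ Z ⊗ X} {b : Y ⊗ Z ≅ Z ⊗ Y} (hf : Slides f.hom a b) :
    Slides f.inv b a := by
  simp only [Slides] at *
  rw [← cancel_epi (f.hom ▷ Z), reassoc_of% hf]
  simp

theorem whiskerLeft {f : X ⟶ Y} {a : X ⊗ Z ≅ Z ⊗ X} {b : Y ⊗ Z ≅ Z ⊗ Y} (c : W ⊗ Z ≅ Z ⊗ W)
    (hf : Slides f a b) : Slides (W ◁ f) (exchangeLeft c a) (exchangeLeft c b) := by
  simp only [Slides, exchangeLeft_hom] at *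
  calc
    _ = 𝟙 _ ⊗≫ W ◁ (f ▷ Z ≫ b.hom) ⊗≫ c.hom ▷ Y ⊗≫ 𝟙 _ := by monoidal
    _ = 𝟙 _ ⊗≫ W ◁ a.hom ⊗≫ ((W ⊗ Z) ◁ f ≫ c.hom ▷ Y) ⊗≫ 𝟙 _ := by rw [hf]; monoidal
    _ = _ := by rw [whisker_exchange]; monoidal

theorem whiskerRight {f : X ⟶ Y} {a : X ⊗ Z ≅ Z ⊗ X} {b : Y ⊗ Z ≅ Z ⊗ Y} (c : W ⊗ Z ≅ Z ⊗ W)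
    (hf : Slides f a b) : Slides (f ▷ W) (exchangeLeft a c) (exchangeLeft b c) := by
  simp only [Slides, exchangeLeft_hom] at *
  calc
    _ = 𝟙 _ ⊗≫ (f ▷ (W ⊗ Z) ≫ Y ◁ c.hom) ⊗≫ b.hom ▷ W ⊗≫ 𝟙 _ := by monoidal
    _ = 𝟙 _ ⊗≫ X ◁ c.hom ⊗≫ (f ▷ Z ≫ b.hom) ▷ W ⊗≫ 𝟙 _ := by
      rw [← whisker_exchange]; monoidal
    _ = _ := by rw [hf]; monoidal

/-- Pure coherence: both sides perform the crossings `c`, `b`, `a` in the same order. -/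
theorem associator (a : W ⊗ Z ≅ Z ⊗ W) (b : X ⊗ Z ≅ Z ⊗ X) (c : Y ⊗ Z ≅ Z ⊗ Y) :
    Slides (α_ W X Y).hom (exchangeLeft (exchangeLeft a b) c)
      (exchangeLeft a (exchangeLeft b c)) := by
  simp only [Slides, exchangeLeft_hom]
  monoidal

theorem leftUnitor (a : X ⊗ Z ≅ Z ⊗ X) :
    Slides (λ_ X).hom (exchangeLeft (exchangeUnit Z) a) a := by
  simp only [Slides, exchangeLeft_hom, exchangeUnit_hom]
  monoidal

theorem rightUnitor (a : X ⊗ Z ≅ Z ⊗ X) :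
    Slides (ρ_ X).hom (exchangeLeft a (exchangeUnit Z)) a := by
  simp only [Slides, exchangeLeft_hom, exchangeUnit_hom]
  monoidal

/-- Moving past the unit object is natural. -/
theorem unit (f : X ⟶ Y) : Slides f (exchangeUnit X).symm (exchangeUnit Y).symm := by
  simp [Slides, exchangeUnit]

theorem exchangeRight {f : X ⟶ Y} {a : X ⊗ W ≅ W ⊗ X} {b : Y ⊗ W ≅ W ⊗ Y}
    {c : X ⊗ Z ≅ Z ⊗ X} {d : Y ⊗ Z ≅ Z ⊗ Y} (h₁ : Slides f a b) (h₂ : Slides f c d) :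
    Slides f (exchangeRight a c) (exchangeRight b d) := by
  simp only [Slides, exchangeRight_hom] at *
  calc
    _ = 𝟙 _ ⊗≫ (f ▷ W ≫ b.hom) ▷ Z ⊗≫ W ◁ d.hom ⊗≫ 𝟙 _ := by monoidal
    _ = 𝟙 _ ⊗≫ a.hom ▷ Z ⊗≫ W ◁ (f ▷ Z ≫ d.hom) ⊗≫ 𝟙 _ := by rw [h₁]; monoidal
    _ = _ := by rw [h₂]; monoidal

theorem symm {f : X ⟶ Y} {a : X ⊗ Z ≅ Z ⊗ X} {b : Y ⊗ Z ≅ Z ⊗ Y}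
    (h : Slides f a b) : Z ◁ f ≫ b.inv = a.inv ≫ f ▷ Z := by
  simp only [Slides] at h
  rw [Iso.eq_inv_comp, ← reassoc_of% h, Iso.hom_inv_id, Category.comp_id]

end Slides

/-- The left side crosses in the order `c, d, a, b`, the right side in the order `c, a, d, b`. The
crossings `a` and `d` involve disjoint factors, so they commute by interchange. -/
theorem exchangeLeft_exchangeRight {W X Y Z : D} (a : W ⊗ Y ≅ Y ⊗ W) (b : W ⊗ Z ≅ Z ⊗ W)
    (c : X ⊗ Y ≅ Y ⊗ X) (d : X ⊗ Z ≅ Z ⊗ X) :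
    exchangeLeft (exchangeRight a b) (exchangeRight c d) =
      exchangeRight (exchangeLeft a c) (exchangeLeft b d) := by
  ext
  simp only [exchangeLeft_hom, exchangeRight_hom]
  calc
    _ = 𝟙 _ ⊗≫ W ◁ c.hom ▷ Z ⊗≫ ((W ⊗ Y) ◁ d.hom ≫ a.hom ▷ (Z ⊗ X)) ⊗≫
        Y ◁ b.hom ▷ X ⊗≫ 𝟙 _ := by monoidal
    _ = _ := by rw [whisker_exchange]; monoidal

theorem exchangeLeft_exchangeUnit_symm (X Y : D) :
    exchangeLeft (exchangeUnit X).symm (exchangeUnit Y).symm = (exchangeUnit (X ⊗ Y)).symm := by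
  ext
  simp [exchangeLeft_hom, exchangeUnit]

theorem exchangeRight_exchangeUnit (X Y : D) :
    exchangeRight (exchangeUnit X) (exchangeUnit Y) = exchangeUnit (X ⊗ Y) := by
  rw [exchangeRight, exchangeLeft_exchangeUnit_symm, Iso.symm_symm_eq]

theorem exchangeUnit_symm_unit : (exchangeUnit (𝟙_ D)).symm = exchangeUnit (𝟙_ D) := by
  ext
  simp [exchangeUnit, unitors_equal, unitors_inv_equal]

end Exchange

/-! ### Interpreting formal morphisms in a quasi-commutative monoid -/

namespace QuasiCommMon

variable {D : Type u₂} [Category.{v₂} D] [MonoidalCategory D] (A : QuasiCommMon D)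

/-- The object of `D` denoted by a formal tensor product. -/
def interpObj : Vines → D
  | .gen => A.X
  | .unit => 𝟙_ D
  | .tensor X Y => interpObj X ⊗ interpObj Y

/-- The braiding with the generator. -/
def braidGen : ∀ X : Vines, A.interpObj X ⊗ A.X ≅ A.X ⊗ A.interpObj X
  | .gen => A.R
  | .unit => exchangeUnit A.X
  | .tensor X Y => exchangeLeft (braidGen X) (braidGen Y)

/-- The braiding of two formal tensor products. -/
def braid (X : Vines) : ∀ Y : Vines, A.interpObj X ⊗ A.interpObj Y ≅ A.interpObj Y ⊗ A.interpObj X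
  | .gen => A.braidGen X
  | .unit => (exchangeUnit (A.interpObj X)).symm
  | .tensor Y Z => exchangeRight (braid X Y) (braid X Z)

/-- The morphism of `D` denoted by a formal morphism. -/
def interpHom : ∀ {X Y : Vines}, Vines.Hom X Y → (A.interpObj X ⟶ A.interpObj Y)
  | _, _, .id _ => 𝟙 _
  | _, _, .comp f g => interpHom f ≫ interpHom g
  | _, _, .whiskerLeft X f => A.interpObj X ◁ interpHom f
  | _, _, .whiskerRight f Y => interpHom f ▷ A.interpObj Y
  | _, _, .α_hom X Y Z => (α_ (A.interpObj X) (A.interpObj Y) (A.interpObj Z)).hom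
  | _, _, .α_inv X Y Z => (α_ (A.interpObj X) (A.interpObj Y) (A.interpObj Z)).inv
  | _, _, .l_hom X => (λ_ (A.interpObj X)).hom
  | _, _, .l_inv X => (λ_ (A.interpObj X)).inv
  | _, _, .ρ_hom X => (ρ_ (A.interpObj X)).hom
  | _, _, .ρ_inv X => (ρ_ (A.interpObj X)).inv
  | _, _, .β_hom X Y => (A.braid X Y).hom
  | _, _, .β_inv X Y => (A.braid X Y).inv
  | _, _, .one => η[A.X]
  | _, _, .mul => μ[A.X]

/-- Needed because `braid` recurses on its second argument, so a composite first argument is only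
unfolded when the second is `gen`. -/
theorem braid_unit_left : ∀ Y : Vines, A.braid .unit Y = exchangeUnit (A.interpObj Y)
  | .gen => rfl
  | .unit => exchangeUnit_symm_unit
  | .tensor Y Z => by
    rw [braid, braid_unit_left Y, braid_unit_left Z]
    exact exchangeRight_exchangeUnit _ _

/-- The source of the second hexagon relation; the first holds by the definition of `braid`. -/
theorem braid_tensor_left (W X : Vines) : ∀ Y : Vines,
    A.braid (W.tensor X) Y = exchangeLeft (A.braid W Y) (A.braid X Y)
  | .gen => rfl
  | .unit => (exchangeLeft_exchangeUnit_symm _ _).symm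
  | .tensor Y Z => by
    rw [braid, braid_tensor_left W X Y, braid_tensor_left W X Z]
    exact (exchangeLeft_exchangeRight _ _ _ _).symm

/-! ### Naturality of the braidings -/

section Slides

variable {A} {Z : D} {c : ∀ X : Vines, A.interpObj X ⊗ Z ≅ Z ⊗ A.interpObj X}

/-- If `Z` can be moved past formal tensor products one factor at a time, and the Yang-Baxter
operator commutes with this, then so do all braidings. -/
theorem slides_braid (hu : c .unit = exchangeUnit Z)
    (ht : ∀ X Y, c (.tensor X Y) = exchangeLeft (c X) (c Y))
    (hR : Slides (A.braid .gen .gen).hom (c (.tensor .gen .gen)) (c (.tensor .gen .gen)))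
    (X Y : Vines) : Slides (A.braid X Y).hom (c (.tensor X Y)) (c (.tensor Y X)) := by
  -- The two inductions mirror the recursions defining `braidGen` and `braid`.
  have hgen : ∀ X : Vines,
      Slides (A.braid X .gen).hom (c (.tensor X .gen)) (c (.tensor .gen X)) := by
    intro X
    induction X with
    | gen => exact hR
    | unit =>
      simp only [ht, hu]
      exact (Slides.leftUnitor _).comp (Slides.rightUnitor _).inv
    | tensor X Y hX hY =>
      simp only [ht] at hX hY ⊢
      exact (Slides.associator _ _ _).comp <| (hY.whiskerLeft _).comp <|
        (Slides.associator _ _ _).inv.comp <| (hX.whiskerRight _).comp (Slides.associator _ _ _)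
  induction Y with
  | gen => exact hgen X
  | unit =>
    simp only [ht, hu]
    exact (Slides.rightUnitor _).comp (Slides.leftUnitor _).inv
  | tensor Y Y' hY hY' =>
    rw [braid, exchangeRight_hom]
    simp only [ht] at hY hY' ⊢
    exact (Slides.associator _ _ _).inv.comp <| (hY.whiskerRight _).comp <|
      (Slides.associator _ _ _).comp <| (hY'.whiskerLeft _).comp (Slides.associator _ _ _).inv

/-- The induction runs over formal morphisms, not their classes, so it can be used before the
interpretation is known to respect the relations. Keeping `c` abstract lets one induction serve both
variables of the braiding. -/
theorem slides_interpHom (hu : c .unit = exchangeUnit Z)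
    (ht : ∀ X Y, c (.tensor X Y) = exchangeLeft (c X) (c Y))
    (hR : Slides (A.braid .gen .gen).hom (c (.tensor .gen .gen)) (c (.tensor .gen .gen)))
    (hone : Slides (A.interpHom .one) (c .unit) (c .gen))
    (hmul : Slides (A.interpHom .mul) (c (.tensor .gen .gen)) (c .gen))
    {X Y : Vines} (f : Vines.Hom X Y) : Slides (A.interpHom f) (c X) (c Y) := by
  induction f with
  | id X => exact Slides.id _
  | comp f g hf hg => exact hf.comp hg
  | whiskerLeft X f hf => rw [ht, ht]; exact hf.whiskerLeft _
  | whiskerRight f Y hf => rw [ht, ht]; exact hf.whiskerRight _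
  | α_hom X Y Z => simp only [ht]; exact Slides.associator _ _ _
  | α_inv X Y Z => simp only [ht]; exact (Slides.associator _ _ _).inv
  | l_hom X => rw [ht, hu]; exact Slides.leftUnitor _
  | l_inv X => rw [ht, hu]; exact (Slides.leftUnitor _).inv
  | ρ_hom X => rw [ht, hu]; exact Slides.rightUnitor _
  | ρ_inv X => rw [ht, hu]; exact (Slides.rightUnitor _).inv
  | β_hom X Y => exact slides_braid hu ht hR X Y
  | β_inv X Y => exact (slides_braid hu ht hR X Y).inv
  | one => exact hone
  | mul => exact hmul

end Slides

theorem slides_right_gen {X Y : Vines} (f : Vines.Hom X Y) :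
    Slides (A.interpHom f) (A.braidGen X) (A.braidGen Y) := by
  refine slides_interpHom rfl (fun _ _ => rfl) ?_ ?_ ?_ f
  · change A.R.hom ▷ A.X ≫ (exchangeLeft A.R A.R).hom =
      (exchangeLeft A.R A.R).hom ≫ A.X ◁ A.R.hom
    -- Yang–Baxter says that `R` itself slides past a third copy of `A.X`.
    simpa [exchangeLeft_hom] using A.yang_baxter =≫ (α_ A.X A.X A.X).hom
  · change η[A.X] ▷ A.X ≫ A.R.hom = (exchangeUnit A.X).hom ≫ A.X ◁ η[A.X]
    simpa [exchangeUnit_hom] using A.one_left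
  · change μ[A.X] ▷ A.X ≫ A.R.hom = (exchangeLeft A.R A.R).hom ≫ A.X ◁ μ[A.X]
    simpa [exchangeLeft_hom] using A.mul_left

/-- Inverting the braidings turns naturality in the second variable into a statement about moving
objects past `A.X` from the left, to which `slides_interpHom` applies. -/
theorem slides_left_gen {X Y : Vines} (f : Vines.Hom X Y) :
    Slides (A.interpHom f) (A.braid .gen X).symm (A.braid .gen Y).symm := by
  -- Both `rfl`s work because `exchangeRight` is defined as the inverse of `exchangeLeft` of the
  -- inverses.
  refine slides_interpHom (c := fun X => (A.braid .gen X).symm) rfl (fun _ _ => rfl) ?_ ?_ ?_ f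
  · change A.R.hom ▷ A.X ≫ (exchangeRight A.R A.R).inv =
      (exchangeRight A.R A.R).inv ≫ A.X ◁ A.R.hom
    -- Clearing the inverses gives Yang–Baxter again, up to an associator.
    rw [Iso.comp_inv_eq, Category.assoc, Iso.eq_inv_comp, exchangeRight_hom]
    have h := (α_ A.X A.X A.X).inv ≫= A.yang_baxter
    simpa using h
  · change η[A.X] ▷ A.X ≫ A.R.inv = (exchangeUnit A.X).hom ≫ A.X ◁ η[A.X]
    rw [Iso.comp_inv_eq, Category.assoc, A.one_right, exchangeUnit_hom]
    simp
  · change μ[A.X] ▷ A.X ≫ A.R.inv = (exchangeRight A.R A.R).inv ≫ A.X ◁ μ[A.X]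
    rw [Iso.comp_inv_eq, Category.assoc, Iso.eq_inv_comp, exchangeRight_hom, A.mul_right]
    simp

theorem slides_right {X Y : Vines} (f : Vines.Hom X Y) : ∀ Z : Vines,
    Slides (A.interpHom f) (A.braid X Z) (A.braid Y Z)
  | .gen => A.slides_right_gen f
  | .unit => Slides.unit _
  | .tensor Z Z' => (slides_right f Z).exchangeRight (slides_right f Z')

theorem slides_left {X Y : Vines} (f : Vines.Hom X Y) : ∀ Z : Vines,
    Slides (A.interpHom f) (A.braid Z X).symm (A.braid Z Y).symm
  | .gen => A.slides_left_gen f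
  | .unit => by
    rw [braid_unit_left, braid_unit_left]
    exact Slides.unit _
  | .tensor Z Z' => by
    rw [braid_tensor_left, braid_tensor_left]
    exact (slides_left f Z).exchangeRight (slides_left f Z')

theorem interpHom_eq {X Y : Vines} {f g : Vines.Hom X Y} (h : Vines.HomEquiv f g) :
    A.interpHom f = A.interpHom g := by
  induction h with
  | refl f => rfl
  | symm _ h => exact h.symm
  | trans _ _ h₁ h₂ => exact h₁.trans h₂
  | comp _ _ h₁ h₂ => simp only [interpHom, h₁, h₂]
  | whiskerLeft X _ h => exact congrArg (A.interpObj X ◁ ·) h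
  | whiskerRight X _ h => exact congrArg (· ▷ A.interpObj X) h
  -- This is `Slides.symm`, which undoes the inversion of the braidings, not symmetry of equality.
  | β_naturality_right X f => exact (A.slides_left f X).symm
  | β_naturality_left f Z => exact A.slides_right f Z
  | hexagon_forward X Y Z =>
    simp only [interpHom, braid, exchangeRight_hom]
    simp [interpObj]
  | hexagon_reverse X Y Z =>
    simp only [interpHom, braid_tensor_left, exchangeLeft_hom]
    simp [interpObj]
  | one_mul => exact MonObj.one_mul A.X
  | mul_one => exact MonObj.mul_one A.X
  | mul_assoc => exact MonObj.mul_assoc A.X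
  | mul_comm => exact A.mul_comm
  | whisker_exchange f g => exact whisker_exchange _ _
  -- What remains are axioms of a monoidal category and invertibility of the braiding.
  | _ => simp [interpHom, interpObj]

/-! ### The monoidal functor attached to a quasi-commutative monoid -/

/-- The functor out of the free braided monoidal category containing a commutative monoid. -/
def interpFunctor : Vines ⥤ D where
  obj := A.interpObj
  map f := Quotient.lift A.interpHom (fun _ _ h => A.interpHom_eq h) f
  map_id _ := rfl
  map_comp := by
    rintro _ _ _ ⟨f⟩ ⟨g⟩
    rfl

/-- `interpFunctor` preserves tensor products strictly. -/
def interpCoreMonoidal : A.interpFunctor.CoreMonoidal where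
  εIso := Iso.refl _
  μIso _ _ := Iso.refl _
  μIso_hom_natural_left := by
    rintro _ _ ⟨f⟩ _
    exact (Category.comp_id _).trans (Category.id_comp _).symm
  μIso_hom_natural_right := by
    rintro _ _ _ ⟨f⟩
    exact (Category.comp_id _).trans (Category.id_comp _).symm
  associativity X Y Z := by
    change 𝟙 (A.interpObj X ⊗ A.interpObj Y) ▷ A.interpObj Z ≫ 𝟙 _ ≫
      (α_ (A.interpObj X) (A.interpObj Y) (A.interpObj Z)).hom = (α_ _ _ _).hom ≫
        A.interpObj X ◁ 𝟙 (A.interpObj Y ⊗ A.interpObj Z) ≫ 𝟙 _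
    simp
  left_unitality X := by
    change (λ_ (A.interpObj X)).hom = 𝟙 (𝟙_ D) ▷ A.interpObj X ≫ 𝟙 _ ≫ (λ_ (A.interpObj X)).hom
    simp
  right_unitality X := by
    change (ρ_ (A.interpObj X)).hom = A.interpObj X ◁ 𝟙 (𝟙_ D) ≫ 𝟙 _ ≫ (ρ_ (A.interpObj X)).hom
    simp

/-- The monoidal functor out of the free braided monoidal category containing a commutative
monoid which is determined by a quasi-commutative monoid. -/
def interp : StrongMonoidalFunctor Vines D where
  toFunctor := A.interpFunctor
  monoidal := A.interpCoreMonoidal.toMonoidal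

/-- The quasi-commutative monoid is recovered from its interpretation. -/
def imageInterpIso : A.interp.image Vines.gen ≅ A where
  hom :=
    { hom := 𝟙 A.X
      -- The two monoid structures live on definitionally the same object and differ by identity
      -- factors, so the instances are given explicitly.
      isMonHom := @IsMonHom.mk _ _ _ _ _ (A.interp.image Vines.gen).mon A.mon _
        (by
          change (𝟙 (𝟙_ D) ≫ η[A.X]) ≫ 𝟙 A.X = η[A.X]
          simp)
        (by
          change (𝟙 (A.X ⊗ A.X) ≫ μ[A.X]) ≫ 𝟙 A.X = (𝟙 A.X ⊗ₘ 𝟙 A.X) ≫ μ[A.X]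
          simp)
      comm := by
        change (𝟙 (A.X ⊗ A.X) ≫ A.R.hom ≫ 𝟙 (A.X ⊗ A.X)) ≫ (𝟙 A.X ⊗ₘ 𝟙 A.X) =
          (𝟙 A.X ⊗ₘ 𝟙 A.X) ≫ A.R.hom
        simp }
  inv :=
    { hom := 𝟙 A.X
      isMonHom := @IsMonHom.mk _ _ _ _ _ A.mon (A.interp.image Vines.gen).mon _
        (by
          change η[A.X] ≫ 𝟙 A.X = 𝟙 (𝟙_ D) ≫ η[A.X]
          simp)
        (by
          change μ[A.X] ≫ 𝟙 A.X = (𝟙 A.X ⊗ₘ 𝟙 A.X) ≫ 𝟙 (A.X ⊗ A.X) ≫ μ[A.X]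
          simp)
      comm := by
        change A.R.hom ≫ (𝟙 A.X ⊗ₘ 𝟙 A.X) =
          (𝟙 A.X ⊗ₘ 𝟙 A.X) ≫ 𝟙 (A.X ⊗ A.X) ≫ A.R.hom ≫ 𝟙 (A.X ⊗ A.X)
        simp }
  hom_inv_id := Hom.ext (Category.comp_id (𝟙 A.X))
  inv_hom_id := Hom.ext (Category.comp_id (𝟙 A.X))

end QuasiCommMon

/-! ### Naturality of tensor-compatible families -/

section Family

open Functor Functor.LaxMonoidal Functor.OplaxMonoidal Functor.Monoidal

variable {C : Type u₁} [Category.{v₁} C] {D : Type u₂} [Category.{v₂} D] {F G : C ⥤ D}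

/-- The family `t` of morphisms is natural with respect to `f`. -/
def NaturalAt (t : ∀ X, F.obj X ⟶ G.obj X) {X Y : C} (f : X ⟶ Y) : Prop :=
  F.map f ≫ t Y = t X ≫ G.map f

namespace NaturalAt

variable {t : ∀ X, F.obj X ⟶ G.obj X} {X Y Z : C}

theorem id (X : C) : NaturalAt t (𝟙 X) := by
  simp [NaturalAt]

theorem comp {f : X ⟶ Y} {g : Y ⟶ Z} (hf : NaturalAt t f) (hg : NaturalAt t g) :
    NaturalAt t (f ≫ g) := by
  simp only [NaturalAt] at *
  rw [F.map_comp, Category.assoc, hg, reassoc_of% hf, G.map_comp]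

theorem inv {f : X ≅ Y} (hf : NaturalAt t f.hom) : NaturalAt t f.inv := by
  simp only [NaturalAt] at *
  rw [← cancel_epi (F.map f.hom), reassoc_of% hf]
  simp [← Functor.map_comp, ← Functor.map_comp_assoc]

variable [MonoidalCategory C] [MonoidalCategory D] [F.Monoidal] [G.Monoidal]

/-- Since `μ F W X` is invertible it can be cancelled; `ht` then splits the components into tensor
products, where naturality at `f` acts on one factor. -/
theorem whiskerLeft (ht : ∀ X Y, LaxMonoidal.μ F X Y ≫ t (X ⊗ Y) = (t X ⊗ₘ t Y) ≫ LaxMonoidal.μ G X Y)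
    (W : C) {f : X ⟶ Y} (hf : NaturalAt t f) : NaturalAt t (W ◁ f) := by
  simp only [NaturalAt] at *
  rw [← cancel_epi (LaxMonoidal.μ F W X), ← μ_natural_right_assoc, ht, reassoc_of% ht, ← μ_natural_right,
    MonoidalCategory.tensorHom_def', MonoidalCategory.tensorHom_def', Category.assoc,
    Category.assoc, ← MonoidalCategory.whiskerLeft_comp_assoc, hf,
    MonoidalCategory.whiskerLeft_comp_assoc, whisker_exchange_assoc]

theorem whiskerRight (ht : ∀ X Y, LaxMonoidal.μ F X Y ≫ t (X ⊗ Y) = (t X ⊗ₘ t Y) ≫ LaxMonoidal.μ G X Y)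
    (W : C) {f : X ⟶ Y} (hf : NaturalAt t f) : NaturalAt t (f ▷ W) := by
  simp only [NaturalAt] at *
  rw [← cancel_epi (LaxMonoidal.μ F X W), ← μ_natural_left_assoc, ht, reassoc_of% ht, ← μ_natural_left,
    MonoidalCategory.tensorHom_def, MonoidalCategory.tensorHom_def, Category.assoc,
    Category.assoc, ← comp_whiskerRight_assoc, hf, comp_whiskerRight_assoc,
    whisker_exchange_assoc]

/-- After cancelling the structure maps of `F`, compatibility with `μ` reduces this to associativity
of both functors and naturality of the associator in `D`. -/
theorem associator (ht : ∀ X Y, LaxMonoidal.μ F X Y ≫ t (X ⊗ Y) = (t X ⊗ₘ t Y) ≫ LaxMonoidal.μ G X Y)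
    (X Y Z : C) : NaturalAt t (α_ X Y Z).hom := by
  simp only [NaturalAt]
  have h₁ : LaxMonoidal.μ F X Y ▷ F.obj Z ≫ (t (X ⊗ Y) ⊗ₘ t Z) =
      ((t X ⊗ₘ t Y) ⊗ₘ t Z) ≫ LaxMonoidal.μ G X Y ▷ G.obj Z := by
    simp only [← tensorHom_id, tensorHom_comp_tensorHom, ht, Category.id_comp, Category.comp_id]
  have h₂ : F.obj X ◁ LaxMonoidal.μ F Y Z ≫ (t X ⊗ₘ t (Y ⊗ Z)) =
      (t X ⊗ₘ (t Y ⊗ₘ t Z)) ≫ G.obj X ◁ LaxMonoidal.μ G Y Z := by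
    simp only [← id_tensorHom, tensorHom_comp_tensorHom, ht, Category.id_comp, Category.comp_id]
  rw [← cancel_epi (LaxMonoidal.μ F (X ⊗ Y) Z), ← cancel_epi (LaxMonoidal.μ F X Y ▷ F.obj Z), LaxMonoidal.associativity_assoc, ht,
    reassoc_of% h₂, reassoc_of% ht, reassoc_of% h₁, LaxMonoidal.associativity, associator_naturality_assoc]

theorem leftUnitor (hu : ε F ≫ t (𝟙_ C) = ε G)
    (ht : ∀ X Y, LaxMonoidal.μ F X Y ≫ t (X ⊗ Y) = (t X ⊗ₘ t Y) ≫ LaxMonoidal.μ G X Y) (X : C) :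
    NaturalAt t (λ_ X).hom := by
  simp only [NaturalAt]
  have h : ε F ▷ F.obj X ≫ (t (𝟙_ C) ⊗ₘ t X) = _ ◁ t X ≫ ε G ▷ G.obj X := by
    rw [MonoidalCategory.tensorHom_def, ← comp_whiskerRight_assoc, hu, whisker_exchange]
  rw [← cancel_epi (LaxMonoidal.μ F (𝟙_ C) X), ← cancel_epi (ε F ▷ F.obj X), ← LaxMonoidal.left_unitality_assoc,
    reassoc_of% ht, reassoc_of% h, ← LaxMonoidal.left_unitality, leftUnitor_naturality]

theorem rightUnitor (hu : ε F ≫ t (𝟙_ C) = ε G)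
    (ht : ∀ X Y, LaxMonoidal.μ F X Y ≫ t (X ⊗ Y) = (t X ⊗ₘ t Y) ≫ LaxMonoidal.μ G X Y) (X : C) :
    NaturalAt t (ρ_ X).hom := by
  simp only [NaturalAt]
  have h : F.obj X ◁ ε F ≫ (t X ⊗ₘ t (𝟙_ C)) = t X ▷ _ ≫ G.obj X ◁ ε G := by
    rw [MonoidalCategory.tensorHom_def', ← MonoidalCategory.whiskerLeft_comp_assoc, hu, whisker_exchange]
  rw [← cancel_epi (LaxMonoidal.μ F X (𝟙_ C)), ← cancel_epi (F.obj X ◁ ε F), ← LaxMonoidal.right_unitality_assoc,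
    reassoc_of% ht, reassoc_of% h, ← LaxMonoidal.right_unitality, rightUnitor_naturality]

end NaturalAt

end Family

/-! ### Monoidal transformations between functors out of `Vines` -/

namespace Vines

open Functor Functor.LaxMonoidal Functor.OplaxMonoidal Functor.Monoidal

variable {D : Type u₂} [Category.{v₂} D] [MonoidalCategory D]

section Natural

variable {F G : Vines ⥤ D} [F.Monoidal] [G.Monoidal] {t : ∀ X, F.obj X ⟶ G.obj X}

/-- The hexagons of `Vines` write every braiding as a composite of structural maps and braidings of
`gen` with itself; no braiding on `D` is involved. -/
theorem naturalAt_braiding (hu : ε F ≫ t (𝟙_ Vines) = ε G)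
    (ht : ∀ X Y : Vines, LaxMonoidal.μ F X Y ≫ t (X ⊗ Y) = (t X ⊗ₘ t Y) ≫ LaxMonoidal.μ G X Y)
    (hβ : NaturalAt t (β_ gen gen).hom) (X Y : Vines) : NaturalAt t (β_ X Y).hom := by
  have hgen : ∀ X : Vines, NaturalAt t (β_ X gen).hom := by
    intro X
    induction X with
    | gen => exact hβ
    | unit =>
      change NaturalAt t (β_ (𝟙_ Vines) gen).hom
      rw [braiding_tensorUnit_left]
      exact (NaturalAt.leftUnitor hu ht _).comp (NaturalAt.rightUnitor hu ht _).inv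
    | tensor X Y hX hY =>
      change NaturalAt t (β_ (X ⊗ Y) gen).hom
      rw [BraidedCategory.braiding_tensor_left_hom]
      exact (NaturalAt.associator ht _ _ _).comp <| (hY.whiskerLeft ht _).comp <|
        (NaturalAt.associator ht _ _ _).inv.comp <| (hX.whiskerRight ht _).comp
          (NaturalAt.associator ht _ _ _)
  induction Y with
  | gen => exact hgen X
  | unit =>
    change NaturalAt t (β_ X (𝟙_ Vines)).hom
    rw [braiding_tensorUnit_right]
    exact (NaturalAt.rightUnitor hu ht _).comp (NaturalAt.leftUnitor hu ht _).inv
  | tensor Y Y' hY hY' =>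
    change NaturalAt t (β_ X (Y ⊗ Y')).hom
    rw [BraidedCategory.braiding_tensor_right_hom]
    exact (NaturalAt.associator ht _ _ _).inv.comp <| (hY.whiskerRight ht _).comp <|
      (NaturalAt.associator ht _ _ _).comp <| (hY'.whiskerLeft ht _).comp
        (NaturalAt.associator ht _ _ _).inv

theorem naturalAt (hu : ε F ≫ t (𝟙_ Vines) = ε G)
    (ht : ∀ X Y : Vines, LaxMonoidal.μ F X Y ≫ t (X ⊗ Y) = (t X ⊗ₘ t Y) ≫ LaxMonoidal.μ G X Y)
    (hβ : NaturalAt t (β_ gen gen).hom) (hone : NaturalAt t η[gen]) (hmul : NaturalAt t μ[gen])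
    {X Y : Vines} (f : X ⟶ Y) : NaturalAt t f := by
  -- Passing to a representative makes induction on formal morphisms available.
  suffices h : ∀ f : Hom X Y, NaturalAt t (Quotient.mk (setoidHom X Y) f : X ⟶ Y) from
    Quotient.inductionOn f h
  clear f
  intro f
  induction f with
  | id X => exact NaturalAt.id X
  | comp f g hf hg => exact hf.comp hg
  | whiskerLeft X f hf => exact hf.whiskerLeft ht X
  | whiskerRight f Y hf => exact hf.whiskerRight ht Y
  | α_hom X Y Z => exact NaturalAt.associator ht X Y Z
  | α_inv X Y Z => exact (NaturalAt.associator ht X Y Z).inv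
  | l_hom X => exact NaturalAt.leftUnitor hu ht X
  | l_inv X => exact (NaturalAt.leftUnitor hu ht X).inv
  | ρ_hom X => exact NaturalAt.rightUnitor hu ht X
  | ρ_inv X => exact (NaturalAt.rightUnitor hu ht X).inv
  | β_hom X Y => exact naturalAt_braiding hu ht hβ X Y
  | β_inv X Y => exact (naturalAt_braiding hu ht hβ X Y).inv
  | one => exact hone
  | mul => exact hmul

end Natural

/-! ### Extension of a morphism from the generator -/

/-- The tensor-compatible family of morphisms with a given value at the generator. -/
def extend (F G : Vines ⥤ D) [F.Monoidal] [G.Monoidal] (h : F.obj gen ⟶ G.obj gen) :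
    ∀ X : Vines, F.obj X ⟶ G.obj X
  | .gen => h
  | .unit => OplaxMonoidal.η F ≫ ε G
  | .tensor X Y => δ F X Y ≫ (extend F G h X ⊗ₘ extend F G h Y) ≫ LaxMonoidal.μ G X Y

theorem ε_extend (F G : Vines ⥤ D) [F.Monoidal] [G.Monoidal] (h : F.obj gen ⟶ G.obj gen) :
    ε F ≫ extend F G h (𝟙_ Vines) = ε G :=
  ε_η_assoc F _

theorem μ_extend (F G : Vines ⥤ D) [F.Monoidal] [G.Monoidal] (h : F.obj gen ⟶ G.obj gen)
    (X Y : Vines) :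
    LaxMonoidal.μ F X Y ≫ extend F G h (X ⊗ Y) = (extend F G h X ⊗ₘ extend F G h Y) ≫ LaxMonoidal.μ G X Y :=
  μ_δ_assoc F X Y _

/-- Monoidality, solved for the component at a unit or tensor product by inverting `ε` and `μ`, is
the recursion defining `extend`. -/
theorem extend_unique {F G : Vines ⥤ D} [F.Monoidal] [G.Monoidal] (τ : F ⟶ G)
    [NatTrans.IsMonoidal τ] : ∀ X : Vines, τ.app X = extend F G (τ.app gen) X
  | .gen => rfl
  | .unit => by
    change τ.app (𝟙_ Vines) = OplaxMonoidal.η F ≫ ε G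
    rw [← NatTrans.IsMonoidal.unit (τ := τ), η_ε_assoc]
  | .tensor X Y => by
    change τ.app (X ⊗ Y) =
      δ F X Y ≫ (extend F G (τ.app gen) X ⊗ₘ extend F G (τ.app gen) Y) ≫ LaxMonoidal.μ G X Y
    rw [← extend_unique τ X, ← extend_unique τ Y, ← NatTrans.IsMonoidal.tensor (τ := τ),
      δ_μ_assoc]

/-- The hypotheses are the fields of a morphism `F.image gen ⟶ G.image gen` with the induced
structures unfolded, so `extendHom` can supply them directly. -/
theorem naturalAt_extend {F G : Vines ⥤ D} [F.Monoidal] [G.Monoidal]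
    {h : F.obj gen ⟶ G.obj gen}
    (hβ : (LaxMonoidal.μ F gen gen ≫ F.map (β_ gen gen).hom ≫ δ F gen gen) ≫ (h ⊗ₘ h) =
      (h ⊗ₘ h) ≫ LaxMonoidal.μ G gen gen ≫ G.map (β_ gen gen).hom ≫ δ G gen gen)
    (hone : (ε F ≫ F.map η[gen]) ≫ h = ε G ≫ G.map η[gen])
    (hmul : (LaxMonoidal.μ F gen gen ≫ F.map μ[gen]) ≫ h =
      (h ⊗ₘ h) ≫ LaxMonoidal.μ G gen gen ≫ G.map μ[gen])
    {X Y : Vines} (f : X ⟶ Y) : NaturalAt (extend F G h) f := by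
  refine naturalAt (ε_extend F G h) (μ_extend F G h) ?_ ?_ ?_ f
  · change F.map (β_ gen gen).hom ≫ δ F gen gen ≫ (h ⊗ₘ h) ≫ LaxMonoidal.μ G gen gen =
      (δ F gen gen ≫ (h ⊗ₘ h) ≫ LaxMonoidal.μ G gen gen) ≫ G.map (β_ gen gen).hom
    have hβ' := δ F gen gen ≫= hβ =≫ LaxMonoidal.μ G gen gen
    simpa only [Category.assoc, δ_μ_assoc, δ_μ, Category.comp_id] using hβ'
  · change F.map η[gen] ≫ h = (OplaxMonoidal.η F ≫ ε G) ≫ G.map η[gen]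
    rw [Category.assoc, ← hone, Category.assoc, η_ε_assoc]
  · change F.map μ[gen] ≫ h = (δ F gen gen ≫ (h ⊗ₘ h) ≫ LaxMonoidal.μ G gen gen) ≫ G.map μ[gen]
    rw [Category.assoc, Category.assoc, ← hmul, Category.assoc, δ_μ_assoc]

/-- The monoidal transformation determined by a homomorphism of quasi-commutative monoids. -/
def extendHom {F G : StrongMonoidalFunctor Vines D} (h : F.image gen ⟶ G.image gen) : F ⟶ G where
  hom :=
    { app := extend F.toFunctor G.toFunctor h.hom
      naturality := fun _ _ f => naturalAt_extend h.comm h.isMonHom.one_hom h.isMonHom.mul_hom f }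
  isMonoidal :=
    { unit := ε_extend F.toFunctor G.toFunctor h.hom
      tensor := μ_extend F.toFunctor G.toFunctor h.hom }

end Vines

/-! ### The equivalence -/

theorem mainTheorem4 (D : Type u₂) [Category.{v₂} D] [MonoidalCategory D] :
    (evalAtCommMonoid Vines.gen : StrongMonoidalFunctor Vines D ⥤ QuasiCommMon D).IsEquivalence where
  faithful :=
    { map_injective := by
        intro F G f g h
        have hgen : f.hom.app Vines.gen = g.hom.app Vines.gen := congrArg QuasiCommMon.Hom.hom h
        refine StrongMonoidalFunctor.Hom.ext (NatTrans.ext (funext fun X => ?_))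
        rw [Vines.extend_unique f.hom, Vines.extend_unique g.hom, hgen] }
  -- `rfl` suffices because `extend` returns the given morphism at `gen`.
  full := { map_surjective := fun h => ⟨Vines.extendHom h, rfl⟩ }
  essSurj := { mem_essImage := fun A => ⟨A.interp, ⟨A.imageInterpIso⟩⟩ }
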